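/- Let $m\ge 1$, $N\ge 0$ and let $S(z)=\sum_{n=-N}^{N}C_nz^n$, $C_n\in\mathbb{C}^{m\times m}$, $C_N\neq 0$, be an $m\times m$ Laurent polynomial matrix function which is positive definite almost everywhere on the unit circle $\mathbb{T}=\{z\in\mathbb{C}:|z|=1\}$. For a (scalar or matrix) polynomial $P(z)=\sum_{n=0}^{k}B_nz^n$ put $\widetilde{P}(z)=\sum_{n=0}^{k}B_n^*z^{-n}$, where $B_n^*$ is the conjugate transpose of $B_n$; that is, $\widetilde P(z)=P(1/\overline{z})^*$ for $z\ne 0$. Let $p$ be any scalar polynomial spectral factor of $\det S$, i.e. a complex polynomial with $p(z)\widetilde{p}(z)=\det S(z)$ for $z\in\mathbb{C}\setminus\{0\}$ and with $\deg p\le L$, where $L$ is the degree of the Laurent polynomial $\det S(z)=\sum_{n=-L}^{L}c_nz^n$, $c_L\ne 0$ (given the first condition, the bound on the degree means that $p(0)\neq 0$). Suppose that $\det S$ has only simple roots in $\mathbb{C}\setminus\{0\}$. Then there exists a polynomial matrix function $P(z)=\sum_{n=0}^{N}B_nz^n$, $B_n\in\mathbb{C}^{m\times m}$, such that $$P(z)\widetilde{P}(z)=S(z)\quad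 (z\in\mathbb{C}\setminus\{0\}),\qquad \det P(z)=p(z)\quad(z\in\mathbb{C}),$$ and it is unique up to a constant unitary right multiplier: if $Q(z)=\sum_{n=0}^{N}D_nz^n$ is another polynomial matrix function with $Q\widetilde{Q}=S$ and $\det Q=p$, then $Q(z)=P(z)U$ for some constant unitary matrix $U\in\mathbb{C}^{m\times m}$. -/

import Mathlib

open scoped LaurentPolynomial Polynomial ComplexOrder

noncomputable section

namespace SpectralFactorization

/-- The value `f(z)` of a complex Laurent polynomial at a nonzero complex number `z`. -/
def evalAt (z : ℂˣ) : ℂ[T;T⁻¹] →+* ℂ :=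
  LaurentPolynomial.eval₂ (RingHom.id ℂ) z

/-- The para-conjugate `f̃(z) = conj (f (1 / conj z))`: the Laurent polynomial `∑ cₙ zⁿ` is sent
to `∑ conj(cₙ) z⁻ⁿ`. -/
def paraConj (f : ℂ[T;T⁻¹]) : ℂ[T;T⁻¹] :=
  LaurentPolynomial.invert (AddMonoidAlgebra.mapRingHom ℤ (starRingEnd ℂ) f)

/-- The adjoint `M̃(z) = (M (1 / conj z))ᴴ` of a Laurent polynomial matrix function: the transpose
of the matrix of the para-conjugates of the entries, so `∑ Aₙ zⁿ` is sent to `∑ Aₙᴴ z⁻ⁿ`. -/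
def paraAdjoint {m : ℕ} (M : Matrix (Fin m) (Fin m) ℂ[T;T⁻¹]) :
    Matrix (Fin m) (Fin m) ℂ[T;T⁻¹] :=
  (M.map paraConj).transpose

/-- The matrix `Cₙ` of the coefficients of `zⁿ` in a Laurent polynomial matrix function. -/
def coeffMatrix {m : ℕ} (S : Matrix (Fin m) (Fin m) ℂ[T;T⁻¹]) (n : ℤ) :
    Matrix (Fin m) (Fin m) ℂ :=
  S.map (fun f => f.coeff n)

/-- `S(z) = ∑_{n=-N}^{N} Cₙ zⁿ` with `C_N ≠ 0`. -/
def HasLaurentDegree {m : ℕ} (S : Matrix (Fin m) (Fin m) ℂ[T;T⁻¹]) (N : ℕ) : Prop :=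
  (∀ n : ℤ, (N : ℤ) < |n| → coeffMatrix S n = 0) ∧ coeffMatrix S (N : ℤ) ≠ 0

/-- `S` is positive definite almost everywhere on the unit circle. -/
def PosDefAEOnCircle {m : ℕ} (S : Matrix (Fin m) (Fin m) ℂ[T;T⁻¹]) : Prop :=
  ∀ᵐ θ : ℝ ∂(MeasureTheory.volume.restrict (Set.Ico 0 (2 * Real.pi))),
    (S.map (evalAt (Circle.toUnits (Circle.exp θ)))).PosDef

/-- All roots in `ℂ \ {0}` of the Laurent polynomial `f` are simple. -/
def OnlySimpleRoots (f : ℂ[T;T⁻¹]) : Prop :=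
  ∀ z : ℂˣ, evalAt z f = 0 →
    ¬ (LaurentPolynomial.T 1 - LaurentPolynomial.C (z : ℂ)) ^ 2 ∣ f

/-- `p` is a scalar polynomial spectral factor of the Laurent polynomial `f`: a polynomial, of
degree at most the degree of `f`, with `p p̃ = f`. (For `f = f̃ ≠ 0` the largest exponent occurring
in `f` is the degree `L` of `f = ∑_{n=-L}^{L} cₙ zⁿ`.) -/
def IsScalarSpectralFactor (p : ℂ[X]) (f : ℂ[T;T⁻¹]) : Prop :=
  (Polynomial.toLaurent p).degree ≤ f.degree ∧
    Polynomial.toLaurent p * paraConj (Polynomial.toLaurent p) = f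

/-- `P(z) = ∑_{n=0}^{N} Bₙ zⁿ` is a polynomial spectral factor of `S`: `P P̃ = S`. -/
def IsSpectralFactor {m : ℕ} (P : Matrix (Fin m) (Fin m) ℂ[X]) (N : ℕ)
    (S : Matrix (Fin m) (Fin m) ℂ[T;T⁻¹]) : Prop :=
  (∀ i j, (P i j).natDegree ≤ N) ∧
    P.map Polynomial.toLaurent * paraAdjoint (P.map Polynomial.toLaurent) = S

end SpectralFactorization

end

/-! ### Laurent polynomials as a star ring; exponents and divisibility -/

namespace SpectralFactorization

open LaurentPolynomial

/-! A common zero of `p` and `p̃` would be a double zero of `det S`, so the two are coprime; in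
particular `p` has no zero on the circle. Existence: at a zero `a` of `p`, a left null vector of
`S(a)` and para-Hermitian symmetry give `S = A S₁ Ã` with `det A` a nonzero multiple of `z - a`
(`exists_split_root`). Splitting off all zeros of `p` leaves a positive definite `D` with nonzero
constant determinant. Since `D⁻¹` is again a Laurent polynomial matrix, positivity makes the
Toeplitz operator `x ↦ (x D)₊` bijective on vectors with positive exponents. This gives a polynomial
`W` with `W(0) = 1` such that `W D` has no positive exponents. Then `W D W̃` is constant, equal to
`h hᴴ`, and `D = V Ṽ` with `V = W⁻¹ h` (`exists_factorization_of_unimodular`). A constant unitary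
factor corrects the determinant. Degree bound: `S · adj(P)̃ = p̃ P` has exponents at most `N`, and
`p(0) ≠ 0` allows `p̃` to be cancelled. Uniqueness: `P⁻¹ Q = P̃ Q̃⁻¹` has denominator `p` on one
side and `p̃` on the other, so it has none; both it and its para-conjugate are polynomial, hence it
is constant. -/

theorem paraConj_coeff (f : ℂ[T;T⁻¹]) (n : ℤ) :
    (paraConj f).coeff n = star (f.coeff (-n)) := by
  simp [paraConj]

/-- Para-conjugation turns the ring of complex Laurent polynomials into a star ring. -/
noncomputable instance : StarRing ℂ[T;T⁻¹] where
  star := paraConj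
  star_involutive f := by
    ext n
    simp only [paraConj_coeff, neg_neg, star_star]
  star_mul f g := by
    simp only [paraConj, map_mul]
    exact mul_comm _ _
  star_add f g := by simp only [paraConj, map_add]

theorem star_eq_paraConj (f : ℂ[T;T⁻¹]) : star f = paraConj f := rfl

@[simp]
theorem star_coeff (f : ℂ[T;T⁻¹]) (n : ℤ) : (star f).coeff n = star (f.coeff (-n)) :=
  paraConj_coeff f n

@[simp]
theorem star_C (a : ℂ) : star (C a) = C (star a) := by
  rw [star_eq_paraConj, paraConj]
  have : (AddMonoidAlgebra.mapRingHom ℤ (starRingEnd ℂ)) (C a) = C (star a) := by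
    ext n
    simp only [AddMonoidAlgebra.coeff_mapRingHom, C_apply]
    by_cases h : n = 0 <;> simp [h]
  rw [this, invert_C]

@[simp]
theorem star_T (n : ℤ) : star (T n : ℂ[T;T⁻¹]) = T (-n) := by
  ext k
  simp only [star_coeff, T_apply]
  by_cases h : n = -k
  · simp [h]
  · have : ¬ -n = k := by omega
    simp [h, this]

@[simp]
theorem evalAt_C (z : ℂˣ) (a : ℂ) : evalAt z (C a) = a := by simp [evalAt]

@[simp]
theorem evalAt_T (z : ℂˣ) (n : ℤ) : evalAt z (T n) = ((z ^ n : ℂˣ) : ℂ) := by simp [evalAt]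

@[simp]
theorem evalAt_toLaurent (z : ℂˣ) (p : ℂ[X]) : evalAt z (Polynomial.toLaurent p) = p.eval (z : ℂ) := by
  simp [evalAt, Polynomial.eval₂_id]

theorem evalAt_star (z : Circle) (f : ℂ[T;T⁻¹]) :
    evalAt (Circle.toUnits z) (star f) = star (evalAt (Circle.toUnits z) f) := by
  induction f using LaurentPolynomial.induction_on' with
  | add p q hp hq => simp only [star_add, map_add, hp, hq]
  | C_mul_T n a =>
    rw [star_mul, star_C, star_T, map_mul, map_mul, evalAt_C, evalAt_C, evalAt_T, evalAt_T, star_mul']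
    rw [mul_comm]
    congr 1
    rw [Units.val_zpow_eq_zpow_val, Units.val_zpow_eq_zpow_val, star_zpow₀, zpow_neg, ← inv_zpow]
    congr 1
    simp [← Circle.coe_inv_eq_conj]

theorem exists_eq_T_mul (f : ℂ[T;T⁻¹]) :
    ∃ (n : ℕ) (q : ℂ[X]), f = T (-n) * Polynomial.toLaurent q := by
  obtain ⟨n, q, h⟩ := exists_T_pow f
  refine ⟨n, q, ?_⟩
  rw [h, mul_comm f, ← mul_assoc, ← T_add]
  simp

theorem T_mul_coeff (f : ℂ[T;T⁻¹]) (n k : ℤ) : (T n * f).coeff k = f.coeff (k - n) := by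
  induction f using LaurentPolynomial.induction_on' with
  | add p q hp hq => rw [mul_add, AddMonoidAlgebra.coeff_add, AddMonoidAlgebra.coeff_add,
      Finsupp.add_apply, Finsupp.add_apply, hp, hq]
  | C_mul_T j a =>
    rw [mul_left_comm, ← T_add, ← single_eq_C_mul_T, ← single_eq_C_mul_T]
    rw [AddMonoidAlgebra.coeff_single, AddMonoidAlgebra.coeff_single,
      Finsupp.single_apply, Finsupp.single_apply]
    congr 1
    apply propext
    omega

theorem toLaurent_coeff_natCast (q : ℂ[X]) (n : ℕ) :
    (Polynomial.toLaurent q).coeff (n : ℤ) = q.coeff n := by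
  rw [coeff_toLaurent]
  exact Finsupp.mapDomain_apply Nat.cast_injective _ _

theorem toLaurent_coeff_neg (q : ℂ[X]) {n : ℤ} (hn : n < 0) :
    (Polynomial.toLaurent q).coeff n = 0 := by
  rw [coeff_toLaurent]
  apply Finsupp.mapDomain_of_notMem_range
  rintro ⟨k, rfl⟩
  simp at hn
  omega

theorem exists_toLaurent_iff (f : ℂ[T;T⁻¹]) :
    (∃ q, Polynomial.toLaurent q = f) ↔ ∀ n < 0, f.coeff n = 0 := by
  constructor
  · rintro ⟨q, rfl⟩ n hn
    exact toLaurent_coeff_neg q hn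
  · intro h
    refine ⟨trunc f, ?_⟩
    obtain ⟨n, q, hq⟩ := exists_eq_T_mul f
    have hX : (Polynomial.X : ℂ[X]) ^ n ∣ q := by
      rw [Polynomial.X_pow_dvd_iff]
      intro d hd
      have := h (d - n) (by omega)
      rwa [hq, T_mul_coeff, sub_neg_eq_add, sub_add_cancel, toLaurent_coeff_natCast] at this
    obtain ⟨r, rfl⟩ := hX
    have : f = Polynomial.toLaurent r := by
      rw [hq, map_mul, Polynomial.toLaurent_X_pow, ← mul_assoc, ← T_add]
      simp
    rw [this, Polynomial.trunc_toLaurent]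

/-- Reflecting exponents by `n ↦ N - n` turns an upper bound on them into polynomiality, which is
stable under products. -/
theorem exists_toLaurent_T_mul_star_iff (f : ℂ[T;T⁻¹]) (N : ℤ) :
    (∃ q, Polynomial.toLaurent q = T N * star f) ↔ ∀ n > N, f.coeff n = 0 := by
  rw [exists_toLaurent_iff]
  constructor
  · intro h n hn
    have := h (N - n) (by omega)
    rw [T_mul_coeff, star_coeff] at this
    simpa using this
  · intro h n hn
    rw [T_mul_coeff, star_coeff, h _ (by omega), star_zero]

theorem mul_star_toLaurent_coeff_eq_zero {f : ℂ[T;T⁻¹]} {N : ℤ} (h : ∀ n > N, f.coeff n = 0)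
    (r : ℂ[X]) : ∀ n > N, (f * star (Polynomial.toLaurent r)).coeff n = 0 := by
  rw [← exists_toLaurent_T_mul_star_iff] at h ⊢
  obtain ⟨q, hq⟩ := h
  refine ⟨q * r, ?_⟩
  rw [map_mul, hq, star_mul, star_star]
  ring

/-- Since `p(0) ≠ 0`, `X` is coprime to `p`, so dividing by `p` cannot create negative exponents. -/
theorem exists_toLaurent_of_mul {p : ℂ[X]} (hp : p.coeff 0 ≠ 0) {h : ℂ[T;T⁻¹]}
    (hs : ∃ s, Polynomial.toLaurent s = Polynomial.toLaurent p * h) :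
    ∃ t, Polynomial.toLaurent t = h := by
  obtain ⟨s, hs⟩ := hs
  obtain ⟨n, r, hr⟩ := exists_eq_T_mul h
  have h1 : p * r = Polynomial.X ^ n * s := by
    apply Polynomial.toLaurent_injective
    rw [map_mul, map_mul, hs, hr, Polynomial.toLaurent_X_pow, mul_left_comm, ← mul_assoc (T (n : ℤ)),
      ← T_add]
    simp
  have hcop : IsCoprime (Polynomial.X ^ n) p := by
    apply IsCoprime.pow_left
    rw [Polynomial.irreducible_X.coprime_iff_not_dvd, Polynomial.X_dvd_iff]
    exact hp
  obtain ⟨t, rfl⟩ := hcop.dvd_of_dvd_mul_left ⟨s, h1⟩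
  refine ⟨t, ?_⟩
  rw [hr, map_mul, Polynomial.toLaurent_X_pow, ← mul_assoc, ← T_add]
  simp

theorem dvd_of_evalAt_eq_zero {f : ℂ[T;T⁻¹]} {z : ℂˣ} (h : evalAt z f = 0) :
    T 1 - C (z : ℂ) ∣ f := by
  obtain ⟨n, q, rfl⟩ := exists_eq_T_mul f
  have hq : q.eval (z : ℂ) = 0 := by
    rw [map_mul, evalAt_toLaurent, evalAt_T] at h
    exact (mul_eq_zero.1 h).resolve_left (Units.ne_zero _)
  have := map_dvd Polynomial.toLaurent (Polynomial.dvd_iff_isRoot.2 hq)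
  rw [map_sub, Polynomial.toLaurent_X, Polynomial.toLaurent_C] at this
  exact this.mul_left _

theorem isCoprime_of_evalAt_ne_zero {f : ℂ[T;T⁻¹]} {z : ℂˣ} (h : evalAt z f ≠ 0) :
    IsCoprime (T 1 - C (z : ℂ)) f := by
  obtain ⟨g, hg⟩ := dvd_of_evalAt_eq_zero (f := f - C (evalAt z f)) (z := z) (by simp)
  refine ⟨-(C (evalAt z f)⁻¹) * g, C (evalAt z f)⁻¹, ?_⟩
  have : C (evalAt z f)⁻¹ * C (evalAt z f) = (1 : ℂ[T;T⁻¹]) := by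
    rw [← map_mul, inv_mul_cancel₀ h, map_one]
  linear_combination this + C (evalAt z f)⁻¹ * hg

theorem eq_zero_of_evalAt_circle {f : ℂ[T;T⁻¹]} {E : Set Circle} (hE : E.Infinite)
    (h : ∀ z ∈ E, evalAt (Circle.toUnits z) f = 0) : f = 0 := by
  obtain ⟨n, q, rfl⟩ := exists_eq_T_mul f
  have : q = 0 := by
    apply Polynomial.eq_zero_of_infinite_isRoot
    refine (hE.image (f := fun z : Circle => (z : ℂ)) Circle.coe_injective.injOn).mono ?_
    rintro _ ⟨z, hz, rfl⟩
    have := h z hz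
    rw [map_mul, evalAt_toLaurent, evalAt_T] at this
    simpa using (mul_eq_zero.1 this).resolve_left (Units.ne_zero _)
  simp [this]

end SpectralFactorization

/-! ### Toeplitz operators of positive definite matrices -/

namespace SpectralFactorization

open LaurentPolynomial Matrix

theorem mul_coeff_eq_zero {f g : ℂ[T;T⁻¹]} {a b : ℤ} (hf : ∀ n > a, f.coeff n = 0)
    (hg : ∀ n > b, g.coeff n = 0) : ∀ n > a + b, (f * g).coeff n = 0 := by
  rw [← exists_toLaurent_T_mul_star_iff] at *
  obtain ⟨q, hq⟩ := hf
  obtain ⟨r, hr⟩ := hg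
  refine ⟨q * r, ?_⟩
  rw [map_mul, hq, hr, star_mul, T_add]
  ring

theorem exists_coeff_bound {ι : Type*} [Finite ι] (f : ι → ℂ[T;T⁻¹]) :
    ∃ N : ℕ, ∀ i, ∀ n > (N : ℤ), (f i).coeff n = 0 := by
  have : Fintype ι := Fintype.ofFinite ι
  have h : ∀ i, ∃ N : ℕ, ∀ n > (N : ℤ), (f i).coeff n = 0 := by
    intro i
    obtain ⟨N, q, hq⟩ := exists_T_pow (star (f i))
    exact ⟨N, (exists_toLaurent_T_mul_star_iff _ _).1 ⟨q, by rw [hq, mul_comm]⟩⟩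
  choose N hN using h
  refine ⟨Finset.univ.sup N, fun i n hn => hN i n ?_⟩
  have : N i ≤ Finset.univ.sup N := Finset.le_sup (Finset.mem_univ i)
  omega

/-- The part of a Laurent polynomial with positive exponents. -/
noncomputable def posPart : ℂ[T;T⁻¹] →ₗ[ℂ] ℂ[T;T⁻¹] where
  toFun f := .ofCoeff (f.coeff.filter (0 < ·))
  map_add' f g := by
    apply AddMonoidAlgebra.coeff_injective
    exact Finsupp.filter_add
  map_smul' c f := by
    apply AddMonoidAlgebra.coeff_injective
    exact Finsupp.filter_smul

theorem posPart_coeff (f : ℂ[T;T⁻¹]) (n : ℤ) :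
    (posPart f).coeff n = if 0 < n then f.coeff n else 0 :=
  Finsupp.filter_apply _ _ _

variable {m : ℕ}

/-- The Toeplitz operator `x ↦ (x D)₊` on row vectors of Laurent polynomials. -/
noncomputable def toeplitz (D : Matrix (Fin m) (Fin m) ℂ[T;T⁻¹]) :
    (Fin m → ℂ[T;T⁻¹]) →ₗ[ℂ] (Fin m → ℂ[T;T⁻¹]) where
  toFun x j := posPart ((x ᵥ* D) j)
  map_add' x y := by
    ext1 j
    simp [add_vecMul]
  map_smul' c x := by
    ext1 j
    simp [smul_vecMul]

theorem toeplitz_apply (D : Matrix (Fin m) (Fin m) ℂ[T;T⁻¹]) (x : Fin m → ℂ[T;T⁻¹]) (j : Fin m) :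
    toeplitz D x j = posPart ((x ᵥ* D) j) := rfl

/-- Vectors of Laurent polynomials all of whose exponents lie in `[1, n]`. -/
def window (m n : ℕ) : Submodule ℂ (Fin m → ℂ[T;T⁻¹]) where
  carrier := {x | ∀ i, ∀ k : ℤ, k ≤ 0 ∨ (n : ℤ) < k → (x i).coeff k = 0}
  add_mem' hx hy i k hk := by simp [hx i k hk, hy i k hk]
  zero_mem' i k _ := by simp
  smul_mem' c x hx i k hk := by simp [hx i k hk]

instance (n : ℕ) : FiniteDimensional ℂ (window m n) := by
  let φ : window m n →ₗ[ℂ] (Fin m → Finset.Icc (1 : ℤ) n → ℂ) :=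
    { toFun := fun x i k => (x.1 i).coeff k
      map_add' := fun x y => by ext; simp
      map_smul' := fun c x => by ext; simp }
  refine FiniteDimensional.of_injective φ ?_
  intro x y h
  ext i k
  by_cases hk : k ≤ 0 ∨ (n : ℤ) < k
  · rw [x.2 i k hk, y.2 i k hk]
  · push Not at hk
    exact congrFun (congrFun h i) ⟨k, by simp; omega⟩

/-- Writing `(x D)₊ = x D - r`, where `r` has exponents at most `0`, gives `(x D)₊ E = x - r E`, and
`r E` has exponents at most `d ≤ n`. -/
theorem toeplitz_toeplitz_mem_window {D E : Matrix (Fin m) (Fin m) ℂ[T;T⁻¹]} (hDE : D * E = 1)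
    {d n : ℕ} (hE : ∀ i j, ∀ k > (d : ℤ), (E i j).coeff k = 0) (hdn : d ≤ n)
    {x : Fin m → ℂ[T;T⁻¹]} (hx : x ∈ window m n) :
    toeplitz E (toeplitz D x) ∈ window m n := by
  intro j k hk
  rw [toeplitz_apply, posPart_coeff]
  split_ifs with hk0
  swap
  · rfl
  have hk' : (n : ℤ) < k := by omega
  have h1 : toeplitz D x = x ᵥ* D - (x ᵥ* D - toeplitz D x) := by abel
  rw [h1, sub_vecMul, vecMul_vecMul, hDE, vecMul_one, Pi.sub_apply, AddMonoidAlgebra.coeff_sub,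
    Finsupp.sub_apply, hx j k hk, zero_sub, neg_eq_zero, vecMul, dotProduct,
    AddMonoidAlgebra.coeff_sum, Finsupp.finsetSum_apply]
  refine Finset.sum_eq_zero fun i _ => mul_coeff_eq_zero (a := 0) (b := d) ?_ (hE i j) k (by omega)
  intro l hl
  rw [Pi.sub_apply, AddMonoidAlgebra.coeff_sub, Finsupp.sub_apply, toeplitz_apply, posPart_coeff,
    if_pos hl, sub_self]

/-- Evaluation at a point of the unit circle. -/
noncomputable def evalCircle (z : Circle) : ℂ[T;T⁻¹] →+* ℂ := evalAt (Circle.toUnits z)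

theorem evalCircle_star (z : Circle) (f : ℂ[T;T⁻¹]) : evalCircle z (star f) = star (evalCircle z f) :=
  evalAt_star z f

theorem conjTranspose_map_evalCircle {n : ℕ} (z : Circle) (M : Matrix (Fin m) (Fin n) ℂ[T;T⁻¹]) :
    Mᴴ.map (evalCircle z) = (M.map (evalCircle z))ᴴ := by
  ext i j
  simp [evalCircle_star]

/-- If `(x D)₊ = 0`, then `x D x̃` has only negative exponents. Being its own para-conjugate it
vanishes, and positivity forces `x = 0` on `E`. -/
theorem eq_zero_of_toeplitz_eq_zero {D : Matrix (Fin m) (Fin m) ℂ[T;T⁻¹]} (hD : Dᴴ = D)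
    {E : Set Circle} (hE : E.Infinite) (hpos : ∀ z ∈ E, (D.map (evalCircle z)).PosDef)
    {x : Fin m → ℂ[T;T⁻¹]} (hx : ∀ i, ∀ k ≤ 0, (x i).coeff k = 0) (h : toeplitz D x = 0) :
    x = 0 := by
  have h1 : ∀ j, ∀ k > 0, ((x ᵥ* D) j).coeff k = 0 := by
    intro j k hk
    have := congrArg (fun f => f.coeff k) (congrFun h j)
    simpa [toeplitz_apply, posPart_coeff, hk] using this
  have h2 : ∀ k > (-1 : ℤ), ((x ᵥ* D) ⬝ᵥ star x).coeff k = 0 := by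
    intro k hk
    rw [dotProduct, AddMonoidAlgebra.coeff_sum, Finsupp.finsetSum_apply]
    refine Finset.sum_eq_zero fun i _ =>
      mul_coeff_eq_zero (a := 0) (b := -1) (h1 i) ?_ k (by omega)
    intro l hl
    rw [Pi.star_apply, star_coeff, hx i _ (by omega), star_zero]
  have h3 : star ((x ᵥ* D) ⬝ᵥ star x) = (x ᵥ* D) ⬝ᵥ star x := by
    rw [← star_dotProduct_star, star_star, star_vecMul, hD, dotProduct_mulVec]
  have h4 : (x ᵥ* D) ⬝ᵥ star x = 0 := by
    ext k
    rcases lt_or_ge (-1) k with hk | hk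
    · exact h2 k hk
    · rw [← h3, star_coeff, h2 _ (by omega)]
      simp
  have h5 : ∀ z ∈ E, ∀ i, evalCircle z (x i) = 0 := by
    intro z hz
    by_contra! hne
    obtain ⟨i, hi⟩ := hne
    have hy : star (fun i => evalCircle z (x i)) ≠ 0 := by
      intro h0
      apply hi
      simpa using congrFun h0 i
    have := (hpos z hz).dotProduct_mulVec_pos hy
    rw [star_star, dotProduct_mulVec] at this
    have h6 := congrArg (evalCircle z) h4
    rw [RingHom.map_dotProduct, map_zero] at h6
    have h7 : evalCircle z ∘ (x ᵥ* D) = (fun i => evalCircle z (x i)) ᵥ* D.map (evalCircle z) := by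
      ext j
      exact RingHom.map_vecMul _ _ _ _
    have h8 : evalCircle z ∘ star x = star (fun i => evalCircle z (x i)) := by
      ext j
      simp [evalCircle_star]
    rw [h7, h8] at h6
    exact this.ne' h6
  ext1 i
  exact eq_zero_of_evalAt_circle hE fun z hz => h5 z hz i

theorem posDef_map_of_mul_eq_one {D E : Matrix (Fin m) (Fin m) ℂ[T;T⁻¹]} (hDE : D * E = 1)
    {z : Circle} (h : (D.map (evalCircle z)).PosDef) : (E.map (evalCircle z)).PosDef := by
  have : E.map (evalCircle z) = (D.map (evalCircle z))⁻¹ := by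
    symm
    apply inv_eq_right_inv
    rw [← Matrix.map_mul, hDE, Matrix.map_one _ (map_zero _) (map_one _)]
  rw [this]
  exact h.inv

theorem toeplitz_coeff_nonpos (D : Matrix (Fin m) (Fin m) ℂ[T;T⁻¹]) (x : Fin m → ℂ[T;T⁻¹])
    (i : Fin m) : ∀ k ≤ 0, (toeplitz D x i).coeff k = 0 := by
  intro k hk
  rw [toeplitz_apply, posPart_coeff, if_neg (by omega)]

/-- The Toeplitz operator of a positive definite unimodular matrix is onto. -/
theorem exists_toeplitz_eq {D F : Matrix (Fin m) (Fin m) ℂ[T;T⁻¹]} (hD : Dᴴ = D)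
    (hDF : D * F = 1) {E : Set Circle} (hE : E.Infinite)
    (hpos : ∀ z ∈ E, (D.map (evalCircle z)).PosDef) {b : Fin m → ℂ[T;T⁻¹]}
    (hb : ∀ i, ∀ k ≤ 0, (b i).coeff k = 0) :
    ∃ x : Fin m → ℂ[T;T⁻¹], (∀ i, ∀ k ≤ 0, (x i).coeff k = 0) ∧ toeplitz D x = b := by
  have hFD : F * D = 1 := mul_eq_one_comm.1 hDF
  have hF : Fᴴ = F := by
    have : Fᴴ * D = 1 := by rw [← hD, ← conjTranspose_mul, hDF, conjTranspose_one]
    rw [← mul_one Fᴴ, ← hDF, ← mul_assoc, this, one_mul]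
  obtain ⟨d, hd⟩ := exists_coeff_bound (fun ij : Fin m × Fin m => D ij.1 ij.2)
  obtain ⟨e, he⟩ := exists_coeff_bound b
  -- The bound `d` makes the window invariant under the composite below; `e` puts `b` inside it.
  set n := max d e
  have hbw : b ∈ window m n := by
    rintro i k (hk | hk)
    · exact hb i k hk
    · exact he i k (by omega)
  -- The composite preserves a finite-dimensional space and is injective because both factors are,
  -- so it is onto.
  let ψ : window m n →ₗ[ℂ] window m n :=
    ((toeplitz D).comp (toeplitz F)).restrict fun x hx =>
      toeplitz_toeplitz_mem_window hFD (fun i j => hd (i, j)) (le_max_left _ _) hx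
  have hinj : Function.Injective ψ := by
    rw [← LinearMap.ker_eq_bot, LinearMap.ker_eq_bot']
    intro x hx
    have h0 : toeplitz D (toeplitz F x.1) = 0 := congrArg Subtype.val hx
    have h1 := eq_zero_of_toeplitz_eq_zero hD hE hpos (toeplitz_coeff_nonpos F x.1) h0
    have h2 := eq_zero_of_toeplitz_eq_zero hF hE
      (fun z hz => posDef_map_of_mul_eq_one hDF (hpos z hz))
      (fun i k hk => x.2 i k (Or.inl hk)) h1
    exact Subtype.ext h2
  obtain ⟨x, hx⟩ := LinearMap.injective_iff_surjective.1 hinj ⟨b, hbw⟩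
  exact ⟨toeplitz F x.1, toeplitz_coeff_nonpos F x.1, congrArg Subtype.val hx⟩

end SpectralFactorization

/-! ### Factorization when the determinant is constant -/

namespace SpectralFactorization

open LaurentPolynomial Matrix

theorem eq_C_of_star_eq_toLaurent {p q : ℂ[X]}
    (h : star (Polynomial.toLaurent p) = Polynomial.toLaurent q) : p = Polynomial.C (p.coeff 0) := by
  ext n
  rcases Nat.eq_zero_or_pos n with rfl | hn
  · simp
  · rw [Polynomial.coeff_C, if_neg hn.ne', ← toLaurent_coeff_natCast, ← star_star (Polynomial.toLaurent p),
      h, star_coeff, toLaurent_coeff_neg _ (by omega), star_zero]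

theorem eq_C_of_coeff_eq_zero {f : ℂ[T;T⁻¹]} (h : ∀ n ≠ 0, f.coeff n = 0) : f = C (f.coeff 0) := by
  ext n
  rw [C_apply]
  split_ifs with hn
  · rw [hn]
  · exact h n hn

open scoped MatrixOrder in
theorem _root_.Matrix.PosDef.exists_eq_mul_conjTranspose {n : Type*} [Fintype n] [DecidableEq n]
    {g : Matrix n n ℂ} (hg : g.PosDef) : ∃ h : Matrix n n ℂ, g = h * hᴴ := by
  refine ⟨CFC.sqrt g, ?_⟩
  have h1 : (CFC.sqrt g)ᴴ = CFC.sqrt g := (CFC.sqrt_nonneg g).posSemidef.isHermitian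
  rw [h1, CFC.sqrt_mul_sqrt_self g hg.posSemidef.nonneg]

variable {m : ℕ}

theorem conjTranspose_map_C (h : Matrix (Fin m) (Fin m) ℂ) :
    (h.map (C : ℂ → ℂ[T;T⁻¹]))ᴴ = hᴴ.map C := by
  ext1 i j
  simp

theorem map_C_map_toLaurent (h : Matrix (Fin m) (Fin m) ℂ) :
    (h.map Polynomial.C).map Polynomial.toLaurent = h.map (C : ℂ → ℂ[T;T⁻¹]) := by
  ext1 i j
  simp

/-- A para-Hermitian unimodular matrix which is positive definite at infinitely many points of the
unit circle is `V Ṽ` for a unimodular polynomial matrix `V`. -/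
theorem exists_factorization_of_unimodular {D : Matrix (Fin m) (Fin m) ℂ[T;T⁻¹]} (hD : Dᴴ = D)
    (hdet : IsUnit D.det) {c : ℂ} (hc : D.det = C c) {E : Set Circle} (hE : E.Infinite)
    (hpos : ∀ z ∈ E, (D.map (evalCircle z)).PosDef) :
    ∃ V : Matrix (Fin m) (Fin m) ℂ[X],
      V.map Polynomial.toLaurent * (V.map Polynomial.toLaurent)ᴴ = D ∧
        ∃ d, V.det = Polynomial.C d := by
  have hDF : D * D⁻¹ = 1 := mul_nonsing_inv D hdet
  -- Each row of the identity is corrected by positive exponents so that its Toeplitz image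
  -- vanishes; these rows form `W`.
  have hex : ∀ i, ∃ x : Fin m → ℂ[T;T⁻¹], (∀ j, ∀ k ≤ 0, (x j).coeff k = 0) ∧
      toeplitz D x = -toeplitz D ((1 : Matrix (Fin m) (Fin m) ℂ[T;T⁻¹]) i) := by
    intro i
    refine exists_toeplitz_eq hD hDF hE hpos ?_
    intro j k hk
    simp [toeplitz_coeff_nonpos D _ j k hk]
  choose y hy0 hy using hex
  have hpoly : ∀ i j, ∃ q, Polynomial.toLaurent q = y i j := by
    intro i j
    rw [exists_toLaurent_iff]
    exact fun n hn => hy0 i j n hn.le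
  choose q hq using hpoly
  have hq0 : ∀ i j, (q i j).coeff 0 = 0 := by
    intro i j
    rw [← toLaurent_coeff_natCast, hq]
    exact hy0 i j _ le_rfl
  let W : Matrix (Fin m) (Fin m) ℂ[X] := 1 + Matrix.of q
  set WL := W.map Polynomial.toLaurent with hWL
  have hWL_row : ∀ i, WL i = (1 : Matrix (Fin m) (Fin m) ℂ[T;T⁻¹]) i + y i := by
    intro i
    ext1 j
    simp only [hWL, W, Matrix.map_apply, Matrix.add_apply, Matrix.of_apply, map_add, hq, Pi.add_apply]
    congr 1
    simp only [Matrix.one_apply]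
    split_ifs <;> simp
  have hW0 : W.det.coeff 0 = 1 := by
    rw [Polynomial.coeff_zero_eq_eval_zero, ← Polynomial.coe_evalRingHom, RingHom.map_det]
    convert Matrix.det_one (n := Fin m) (R := ℂ)
    ext i j
    simp only [W, RingHom.mapMatrix_apply, Matrix.map_apply, Matrix.add_apply, Matrix.of_apply, map_add,
      Polynomial.coe_evalRingHom, ← Polynomial.coeff_zero_eq_eval_zero, hq0, add_zero]
    simp only [Matrix.one_apply]
    split_ifs <;> simp
  have hWLdet : WL.det = Polynomial.toLaurent W.det := (RingHom.map_det _ _).symm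
  have hWD : ∀ i j, ∀ k > 0, ((WL * D) i j).coeff k = 0 := by
    intro i j k hk
    have h1 : toeplitz D (WL i) = 0 := by
      rw [hWL_row, map_add, hy, add_neg_cancel]
    have h2 := congrArg (fun f => f.coeff k) (congrFun h1 j)
    simp only [toeplitz_apply, posPart_coeff, if_pos hk] at h2
    exact h2
  set G := WL * D * WLᴴ with hG
  have hGs : Gᴴ = G := by
    rw [hG, conjTranspose_mul, conjTranspose_mul, hD, conjTranspose_conjTranspose, mul_assoc]
  -- Neither `W D` nor `W̃` has positive exponents; with `Gᴴ = G` this makes `G` constant.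
  have hGpos : ∀ i j, ∀ k > 0, (G i j).coeff k = 0 := by
    intro i j k hk
    rw [hG, Matrix.mul_apply, AddMonoidAlgebra.coeff_sum, Finsupp.finsetSum_apply]
    exact Finset.sum_eq_zero fun l _ =>
      mul_star_toLaurent_coeff_eq_zero (hWD i l) (W j l) k hk
  set g := G.map (fun f => f.coeff 0) with hg
  have hGg : G = g.map (C : ℂ → ℂ[T;T⁻¹]) := by
    ext1 i j
    refine eq_C_of_coeff_eq_zero fun n hn => ?_
    rcases lt_or_gt_of_ne hn with h | h
    · rw [← hGs, conjTranspose_apply, star_coeff, hGpos _ _ _ (by omega), star_zero]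
    · exact hGpos _ _ _ h
  have hgpos : g.PosDef := by
    have : ∃ z ∈ E, evalCircle z WL.det ≠ 0 := by
      by_contra! h
      have := eq_zero_of_evalAt_circle hE h
      rw [hWLdet, Polynomial.toLaurent_eq_zero] at this
      simp [this] at hW0
    obtain ⟨z, hz, hzd⟩ := this
    have h1 : g = WL.map (evalCircle z) * D.map (evalCircle z) * (WL.map (evalCircle z))ᴴ := by
      rw [← conjTranspose_map_evalCircle, ← Matrix.map_mul, ← Matrix.map_mul, ← hG, hGg]
      ext i j
      simp [evalCircle]
    rw [h1]
    refine (hpos z hz).mul_mul_conjTranspose_same ?_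
    apply vecMul_injective_of_isUnit
    rw [isUnit_iff_isUnit_det, ← RingHom.mapMatrix_apply, ← RingHom.map_det]
    exact isUnit_iff_ne_zero.2 hzd
  obtain ⟨h, hh⟩ := hgpos.exists_eq_mul_conjTranspose
  -- The product `det W · c · (det W)̃` is constant and `det W` is nonzero at `0`, so `(det W)̃` is
  -- a polynomial too. Hence `det W` is constant, equal to its value `1` at `0`.
  have hWdet : W.det = 1 := by
    have h1 : C g.det = Polynomial.toLaurent W.det * (C c * star (Polynomial.toLaurent W.det)) := by
      rw [← hWLdet, ← hc, ← det_conjTranspose, ← mul_assoc, ← det_mul, ← det_mul, ← hG, hGg]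
      exact RingHom.map_det _ _
    have hc0 : c ≠ 0 := by
      rintro rfl
      rw [hc, map_zero] at hdet
      exact not_isUnit_zero hdet
    obtain ⟨t, ht⟩ := exists_toLaurent_of_mul (p := W.det) (by rw [hW0]; exact one_ne_zero)
      ⟨Polynomial.C g.det, by rw [Polynomial.toLaurent_C, h1]⟩
    have h2 : star (Polynomial.toLaurent W.det) =
        Polynomial.toLaurent (Polynomial.C c⁻¹ * t) := by
      rw [map_mul, ht, Polynomial.toLaurent_C, ← mul_assoc, ← map_mul, inv_mul_cancel₀ hc0, map_one,
        one_mul]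
    rw [eq_C_of_star_eq_toLaurent h2, hW0, map_one]
  have hVL : (W.adjugate * h.map Polynomial.C).map Polynomial.toLaurent =
      WL.adjugate * h.map (C : ℂ → ℂ[T;T⁻¹]) := by
    rw [Matrix.map_mul, map_C_map_toLaurent]
    congr 1
    exact RingHom.map_adjugate _ _
  have hadj : WL.adjugate * WL = 1 := by
    rw [adjugate_mul, hWLdet, hWdet, map_one, one_smul]
  refine ⟨W.adjugate * h.map Polynomial.C, ?_, h.det, ?_⟩
  · have h1 : h.map (C : ℂ → ℂ[T;T⁻¹]) * (h.map C)ᴴ = WL * D * WLᴴ := by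
      rw [conjTranspose_map_C, ← Matrix.map_mul, ← hh, ← hGg]
    rw [hVL, conjTranspose_mul]
    calc _ = WL.adjugate * (h.map (C : ℂ → ℂ[T;T⁻¹]) * (h.map C)ᴴ) * WL.adjugateᴴ := by
          simp only [mul_assoc]
      _ = (WL.adjugate * WL) * D * (WL.adjugate * WL)ᴴ := by
          rw [h1, conjTranspose_mul]
          simp only [mul_assoc]
      _ = D := by rw [hadj, conjTranspose_one, one_mul, mul_one]
  · rw [det_mul, det_adjugate, hWdet, one_pow, one_mul]
    exact (RingHom.map_det _ _).symm

end SpectralFactorization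

/-! ### Splitting off the zeros of the determinant -/

namespace SpectralFactorization

open LaurentPolynomial Matrix

variable {m : ℕ}

theorem toLaurent_X_sub_C (a : ℂ) :
    Polynomial.toLaurent (Polynomial.X - Polynomial.C a) = T 1 - C a := by
  rw [map_sub, Polynomial.toLaurent_X, Polynomial.toLaurent_C]

theorem det_updateRow_one (i : Fin m) (u : Fin m → ℂ) :
    ((1 : Matrix (Fin m) (Fin m) ℂ).updateRow i u).det = u i := by
  rw [← cramer_transpose_apply, transpose_one, cramer_one]
  rfl

theorem isCoprime_star_linear {z : ℂˣ} (hz : ‖(z : ℂ)‖ ≠ 1) :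
    IsCoprime (T 1 - C (z : ℂ)) (star (T 1 - C (z : ℂ)) : ℂ[T;T⁻¹]) := by
  apply isCoprime_of_evalAt_ne_zero
  intro h
  apply hz
  rw [star_sub, star_T, star_C, map_sub, evalAt_T, evalAt_C, sub_eq_zero, _root_.zpow_neg, _root_.zpow_one] at h
  have h1 : (z : ℂ) * star (z : ℂ) = 1 := by rw [← h, Units.mul_inv]
  have h2 := congrArg norm h1
  rw [norm_mul, norm_star, norm_one] at h2
  nlinarith [norm_nonneg (z : ℂ)]

/-- A zero of the determinant off the unit circle can be split off symmetrically. -/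
theorem exists_split_root {S : Matrix (Fin m) (Fin m) ℂ[T;T⁻¹]} (hS : Sᴴ = S) {z : ℂˣ}
    (hz : ‖(z : ℂ)‖ ≠ 1) (hdet : evalAt z S.det = 0) :
    ∃ (A : Matrix (Fin m) (Fin m) ℂ[X]) (S₁ : Matrix (Fin m) (Fin m) ℂ[T;T⁻¹]) (b : ℂ),
      b ≠ 0 ∧ A.det = Polynomial.C b * (Polynomial.X - Polynomial.C (z : ℂ)) ∧ S₁ᴴ = S₁ ∧
        S = A.map Polynomial.toLaurent * S₁ * (A.map Polynomial.toLaurent)ᴴ := by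
  rw [RingHom.map_det, RingHom.mapMatrix_apply, ← exists_vecMul_eq_zero_iff] at hdet
  obtain ⟨u, hu, huS⟩ := hdet
  obtain ⟨i₀, hi₀⟩ := Function.ne_iff.1 hu
  rw [Pi.zero_apply] at hi₀
  -- Placing the null vector `u` of `S(z)` in row `i₀` makes that row of `B S B̃` vanish at `z`;
  -- invertibility needs only `u i₀ ≠ 0`.
  set B : Matrix (Fin m) (Fin m) ℂ := (1 : Matrix (Fin m) (Fin m) ℂ).updateRow i₀ u with hB
  have hBdet : B.det = u i₀ := det_updateRow_one i₀ u
  have hBu : IsUnit B.det := by rw [hBdet]; exact isUnit_iff_ne_zero.2 hi₀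
  set BL : Matrix (Fin m) (Fin m) ℂ[T;T⁻¹] := B.map C with hBL
  set K := BL * S * BLᴴ with hK
  have hKs : Kᴴ = K := by
    rw [hK, conjTranspose_mul, conjTranspose_mul, hS, conjTranspose_conjTranspose, mul_assoc]
  have hrow : ∀ j, T 1 - C (z : ℂ) ∣ K i₀ j := by
    intro j
    apply dvd_of_evalAt_eq_zero
    have h1 : (BL * S).map (evalAt z) i₀ = 0 := by
      rw [Matrix.map_mul]
      have h2 : BL.map (evalAt z) = B := by
        ext i j
        simp [hBL]
      rw [h2, mul_apply_eq_vecMul, hB, updateRow_self, huS]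
    rw [hK, Matrix.mul_apply, map_sum]
    refine Finset.sum_eq_zero fun k _ => ?_
    have h3 : evalAt z ((BL * S) i₀ k) = 0 := congrFun h1 k
    rw [map_mul, h3, zero_mul]
  have hcol : ∀ i, star (T 1 - C (z : ℂ)) ∣ K i i₀ := by
    intro i
    obtain ⟨g, hg⟩ := hrow i
    refine ⟨star g, ?_⟩
    rw [← hKs, conjTranspose_apply, hg, star_mul, mul_comm]
  set δ : Fin m → ℂ[X] :=
    Function.update 1 i₀ (Polynomial.X - Polynomial.C (z : ℂ)) with hδ
  have hδ₀ : Polynomial.toLaurent (δ i₀) = T 1 - C (z : ℂ) := by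
    rw [hδ, Function.update_self, toLaurent_X_sub_C]
  have hδ₁ : ∀ i, i ≠ i₀ → Polynomial.toLaurent (δ i) = 1 := by
    intro i hi
    rw [hδ, Function.update_of_ne hi, Pi.one_apply, map_one]
  have hδne : ∀ i, Polynomial.toLaurent (δ i) ≠ 0 := by
    intro i
    rw [Polynomial.toLaurent_ne_zero, hδ]
    by_cases hi : i = i₀
    · rw [hi, Function.update_self]
      exact Polynomial.X_sub_C_ne_zero _
    · rw [Function.update_of_ne hi]
      exact one_ne_zero
  -- Only the corner entry needs both factors at once; they are coprime because `|z| ≠ 1`.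
  have hdvd : ∀ i j, Polynomial.toLaurent (δ i) * star (Polynomial.toLaurent (δ j)) ∣ K i j := by
    intro i j
    by_cases hi : i = i₀ <;> by_cases hj : j = i₀
    · subst hi
      subst hj
      rw [hδ₀]
      exact (isCoprime_star_linear hz).mul_dvd (hrow _) (hcol _)
    · subst hi
      rw [hδ₁ j hj, hδ₀, star_one, mul_one]
      exact hrow j
    · subst hj
      rw [hδ₁ i hi, hδ₀, one_mul]
      exact hcol i
    · rw [hδ₁ i hi, hδ₁ j hj, star_one, mul_one]
      exact one_dvd _
  choose s hs using hdvd
  let S₁ : Matrix (Fin m) (Fin m) ℂ[T;T⁻¹] := Matrix.of s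
  set Δ : Matrix (Fin m) (Fin m) ℂ[T;T⁻¹] := diagonal fun i => Polynomial.toLaurent (δ i) with hΔ
  have hKS : K = Δ * S₁ * Δᴴ := by
    ext1 i j
    rw [hs i j, hΔ, diagonal_conjTranspose, mul_diagonal, diagonal_mul]
    simp only [S₁, Matrix.of_apply, Pi.star_apply]
    ring
  have hS₁ : S₁ᴴ = S₁ := by
    ext1 i j
    have h1 : Polynomial.toLaurent (δ i) * star (Polynomial.toLaurent (δ j)) ≠ 0 :=
      mul_ne_zero (hδne i) (star_ne_zero.2 (hδne j))
    apply mul_left_cancel₀ h1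
    have h2 : star (K j i) = K i j := by rw [← conjTranspose_apply, hKs]
    rw [hs i j, hs j i] at h2
    simp only [star_mul, star_star] at h2
    simp only [conjTranspose_apply, S₁, Matrix.of_apply]
    linear_combination h2
  set BI : Matrix (Fin m) (Fin m) ℂ[T;T⁻¹] := B⁻¹.map C with hBI
  have hBIB : BI * BL = 1 := by
    rw [hBI, hBL, ← Matrix.map_mul, nonsing_inv_mul _ hBu, Matrix.map_one _ (map_zero _) (map_one _)]
  have hAL : (B⁻¹.map Polynomial.C * diagonal δ).map Polynomial.toLaurent = BI * Δ := by
    rw [Matrix.map_mul, map_C_map_toLaurent, diagonal_map (map_zero _)]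
  refine ⟨B⁻¹.map Polynomial.C * diagonal δ, S₁, (B⁻¹).det, ?_, ?_, hS₁, ?_⟩
  · rw [det_nonsing_inv, Ring.inverse_eq_inv', hBdet]
    exact inv_ne_zero hi₀
  · rw [det_mul, det_diagonal, hδ, Finset.prod_update_of_mem (Finset.mem_univ _)]
    simp only [Pi.one_apply, Finset.prod_const_one, mul_one]
    congr 1
    exact (RingHom.map_det _ _).symm
  · rw [hAL, conjTranspose_mul]
    calc S = (BI * BL) * S * (BI * BL)ᴴ := by rw [hBIB, conjTranspose_one, one_mul, mul_one]
      _ = BI * K * BIᴴ := by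
          rw [conjTranspose_mul, hK]
          simp only [mul_assoc]
      _ = _ := by
          rw [hKS]
          simp only [mul_assoc]

/-- Induction on the degree of `p`, removing one zero at a time. The constant `c` absorbs the
factors `|b|⁻²` left by the splittings. The set `E` never shrinks, because `A` is invertible at
every point of the circle. -/
theorem exists_factorization_up_to_const (n : ℕ) :
    ∀ (p : ℂ[X]) (S : Matrix (Fin m) (Fin m) ℂ[T;T⁻¹]) (c : ℂ) (E : Set Circle), p.natDegree = n →
      p.coeff 0 ≠ 0 → (∀ z : Circle, p.eval (z : ℂ) ≠ 0) → Sᴴ = S → E.Infinite →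
      (∀ z ∈ E, (S.map (evalCircle z)).PosDef) → c ≠ 0 →
      S.det = C c * (Polynomial.toLaurent p * star (Polynomial.toLaurent p)) →
      ∃ (P : Matrix (Fin m) (Fin m) ℂ[X]) (d : ℂ),
        P.map Polynomial.toLaurent * (P.map Polynomial.toLaurent)ᴴ = S ∧
          P.det = Polynomial.C d * p := by
  induction n with
  | zero =>
    intro p S c E hn hp0 _ hS hE hpos hc hdet
    obtain ⟨a, rfl⟩ := Polynomial.natDegree_eq_zero.1 hn
    rw [Polynomial.coeff_C_zero] at hp0
    rw [Polynomial.toLaurent_C, star_C, ← map_mul, ← map_mul] at hdet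
    have hu : IsUnit S.det := by
      rw [hdet]
      exact (isUnit_iff_ne_zero.2 (mul_ne_zero hc (mul_ne_zero hp0 (star_ne_zero.2 hp0)))).map C
    obtain ⟨V, hV, d, hd⟩ := exists_factorization_of_unimodular hS hu hdet hE hpos
    refine ⟨V, d * a⁻¹, hV, ?_⟩
    rw [← map_mul, mul_assoc, inv_mul_cancel₀ hp0, mul_one, hd]
  | succ n ih =>
    intro p S c E hn hp0 hpc hS hE hpos hc hdet
    obtain ⟨a, ha⟩ := IsAlgClosed.exists_root p (by
      intro h
      rw [Polynomial.natDegree_eq_zero_iff_degree_le_zero.2 h.le] at hn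
      omega)
    obtain ⟨q, rfl⟩ := Polynomial.dvd_iff_isRoot.2 ha
    have hane : a ≠ 0 := by
      rintro rfl
      simp at hp0
    have hnorm : ‖a‖ ≠ 1 := by
      intro h
      exact hpc ⟨a, by simpa [Submonoid.unitSphere] using h⟩ ha
    obtain ⟨A, S₁, b, hb, hA, hS₁, hSA⟩ := exists_split_root (z := Units.mk0 a hane) hS hnorm (by
      rw [hdet, map_mul, map_mul, evalAt_toLaurent, Units.val_mk0, ha.eq_zero, zero_mul, mul_zero])
    rw [Units.val_mk0] at hA
    set l := Polynomial.toLaurent (Polynomial.X - Polynomial.C a) with hl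
    have hlne : l ≠ 0 := Polynomial.toLaurent_ne_zero.2 (Polynomial.X_sub_C_ne_zero _)
    have hAL : (A.map Polynomial.toLaurent).det = C b * l := by
      rw [hl, ← Polynomial.toLaurent_C, ← map_mul, ← hA]
      exact (RingHom.map_det _ _).symm
    have hq0 : q.coeff 0 ≠ 0 := by
      rw [Polynomial.mul_coeff_zero] at hp0
      exact right_ne_zero_of_mul hp0
    have hqne : q ≠ 0 := by
      rintro rfl
      simp at hq0
    have hdet₁ : S₁.det = C (c * (b * star b)⁻¹) *
        (Polynomial.toLaurent q * star (Polynomial.toLaurent q)) := by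
      have h1 : C (b * star b) * (l * star l) ≠ 0 := by
        refine mul_ne_zero ?_ (mul_ne_zero hlne (star_ne_zero.2 hlne))
        rw [← Polynomial.toLaurent_C, Polynomial.toLaurent_ne_zero, Polynomial.C_ne_zero]
        exact mul_ne_zero hb (star_ne_zero.2 hb)
      apply mul_left_cancel₀ h1
      have h2 : S.det = C (b * star b) * (l * star l) * S₁.det := by
        rw [hSA, det_mul, det_mul, det_conjTranspose, hAL, star_mul, star_C, map_mul]
        ring
      have h3 : C (b * star b) * C (c * (b * star b)⁻¹) = (C c : ℂ[T;T⁻¹]) := by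
        rw [← map_mul, mul_left_comm, mul_inv_cancel₀ (mul_ne_zero hb (star_ne_zero.2 hb)), mul_one]
      rw [← h2, hdet, map_mul, star_mul, ← hl, ← h3]
      ring
    have hpos₁ : ∀ z ∈ E, (S₁.map (evalCircle z)).PosDef := by
      intro z hz
      have h1 := hpos z hz
      rw [hSA, Matrix.map_mul, Matrix.map_mul, conjTranspose_map_evalCircle] at h1
      refine (Matrix.IsUnit.posDef_star_right_conjugate_iff ?_).1 h1
      rw [isUnit_iff_isUnit_det, ← RingHom.mapMatrix_apply, ← RingHom.map_det, isUnit_iff_ne_zero, hAL,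
        map_mul, hl]
      have h2 := hpc z
      rw [Polynomial.eval_mul] at h2
      simpa [evalCircle, hb] using left_ne_zero_of_mul h2
    obtain ⟨P, d, hP, hPd⟩ := ih q S₁ _ E
      (by
        rw [Polynomial.natDegree_mul (Polynomial.X_sub_C_ne_zero _) hqne,
          Polynomial.natDegree_X_sub_C] at hn
        omega) hq0
      (fun z => by
        have := hpc z
        rw [Polynomial.eval_mul] at this
        exact right_ne_zero_of_mul this)
      hS₁ hE hpos₁ (mul_ne_zero hc (inv_ne_zero (mul_ne_zero hb (star_ne_zero.2 hb)))) hdet₁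
    refine ⟨A * P, b * d, ?_, ?_⟩
    · rw [Matrix.map_mul, conjTranspose_mul, hSA, ← hP]
      simp only [mul_assoc]
    · rw [det_mul, hA, hPd, map_mul]
      ring

end SpectralFactorization

/-! ### Consequences of the hypotheses on `p` and `S` -/

namespace SpectralFactorization

open LaurentPolynomial Matrix

variable {m : ℕ}

theorem isCoprime_toLaurent {p : ℂ[X]} (hp : p.coeff 0 ≠ 0) {g : ℂ[T;T⁻¹]}
    (h : ∀ z : ℂˣ, p.eval (z : ℂ) = 0 → evalAt z g ≠ 0) : IsCoprime (Polynomial.toLaurent p) g := by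
  have hp0 : p ≠ 0 := by
    rintro rfl
    simp at hp
  rw [(IsAlgClosed.splits p).eq_prod_roots, map_mul]
  apply IsCoprime.mul_left
  · rw [Polynomial.toLaurent_C]
    refine ((isCoprime_one_left).of_isCoprime_of_dvd_left ?_)
    exact ((isUnit_iff_ne_zero.2 (Polynomial.leadingCoeff_ne_zero.2 hp0)).map C).dvd
  · refine Multiset.prod_induction (fun q => IsCoprime (Polynomial.toLaurent q) g) _ ?_ ?_ ?_
    · intro a b ha hb
      rw [map_mul]
      exact ha.mul_left hb
    · rw [map_one]
      exact isCoprime_one_left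
    · intro q hq
      obtain ⟨a, ha, rfl⟩ := Multiset.mem_map.1 hq
      have har : p.eval a = 0 := (Polynomial.mem_roots hp0).1 ha
      have hane : a ≠ 0 := by
        rintro rfl
        exact hp (by rw [Polynomial.coeff_zero_eq_eval_zero, har])
      rw [toLaurent_X_sub_C]
      exact isCoprime_of_evalAt_ne_zero (z := Units.mk0 a hane) (h (Units.mk0 a hane) har)

theorem evalAt_star_ne_zero_of_onlySimpleRoots {p : ℂ[X]}
    (h : OnlySimpleRoots (Polynomial.toLaurent p * star (Polynomial.toLaurent p))) {z : ℂˣ}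
    (hz : p.eval (z : ℂ) = 0) : evalAt z (star (Polynomial.toLaurent p)) ≠ 0 := by
  intro h0
  have h1 : evalAt z (Polynomial.toLaurent p) = 0 := by rw [evalAt_toLaurent, hz]
  refine h z (by rw [map_mul, h1, zero_mul]) ?_
  rw [sq]
  exact mul_dvd_mul (dvd_of_evalAt_eq_zero h1) (dvd_of_evalAt_eq_zero h0)

/-- If `p = X q`, then `p p̃ = q q̃` because `z · z⁻¹ = 1`, so `f` has degree at most `deg q < deg
p`, against the degree bound. -/
theorem coeff_zero_ne_zero_of_isScalarSpectralFactor {p : ℂ[X]} {f : ℂ[T;T⁻¹]} (hf : f ≠ 0)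
    (hp : IsScalarSpectralFactor p f) : p.coeff 0 ≠ 0 := by
  intro h0
  obtain ⟨q, rfl⟩ := Polynomial.X_dvd_iff.2 h0
  have hq : q ≠ 0 := by
    rintro rfl
    apply hf
    rw [← hp.2]
    simp
  have h1 : f = Polynomial.toLaurent q * star (Polynomial.toLaurent q) := by
    have hT : (T 1 : ℂ[T;T⁻¹]) * T (-1) = 1 := by rw [← T_add]; simp
    rw [← hp.2, ← star_eq_paraConj, map_mul, Polynomial.toLaurent_X, star_mul, star_T]
    linear_combination (Polynomial.toLaurent q * star (Polynomial.toLaurent q)) * hT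
  have h2 : ∀ n > (q.natDegree : ℤ), f.coeff n = 0 := by
    rw [h1]
    apply mul_star_toLaurent_coeff_eq_zero
    intro n hn
    lift n to ℕ using by omega
    rw [toLaurent_coeff_natCast, Polynomial.coeff_eq_zero_of_natDegree_lt (by omega)]
  have h3 : ((q.natDegree + 1 : ℕ) : ℤ) ∈ (Polynomial.toLaurent (Polynomial.X * q)).coeff.support := by
    rw [Finsupp.mem_support_iff, toLaurent_coeff_natCast, Polynomial.coeff_X_mul]
    exact Polynomial.leadingCoeff_ne_zero.2 hq
  have h4 : (((q.natDegree + 1 : ℕ) : ℤ) : WithBot ℤ) ≤ f.degree :=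
    (Finset.le_max h3).trans hp.1
  obtain ⟨k, hk⟩ := WithBot.ne_bot_iff_exists.1 (mt degree_eq_bot_iff.1 hf)
  rw [← hk, WithBot.coe_le_coe] at h4
  have h5 : k ∈ f.coeff.support := Finset.mem_of_max hk.symm
  exact Finsupp.mem_support_iff.1 h5 (h2 k (by push_cast at h4; omega))

/-- A finite set of points would pull back to finitely many angles in `[0, 2π)`, a null set. -/
theorem infinite_posDef_of_posDefAEOnCircle {S : Matrix (Fin m) (Fin m) ℂ[T;T⁻¹]}
    (h : PosDefAEOnCircle S) : {z : Circle | (S.map (evalCircle z)).PosDef}.Infinite := by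
  intro hfin
  have h1 : ({θ : ℝ | (S.map (evalCircle (Circle.exp θ))).PosDef} ∩
      Set.Ico 0 (2 * Real.pi)).Finite := by
    refine Set.Finite.of_finite_image (f := Circle.exp) (hfin.subset ?_) ?_
    · rintro _ ⟨θ, hθ, rfl⟩
      exact hθ.1
    · intro x hx y hy hxy
      obtain ⟨k, hk⟩ := Circle.exp_eq_exp.1 hxy
      have hpi := Real.pi_pos
      have hk1 : (k : ℝ) < 1 := by
        by_contra! hc
        nlinarith [hx.2.1, hx.2.2, hy.2.1, hy.2.2]
      have hk2 : (-1 : ℝ) < k := by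
        by_contra! hc
        nlinarith [hx.2.1, hx.2.2, hy.2.1, hy.2.2]
      have : k = 0 := by
        have : k < 1 := by exact_mod_cast hk1
        have : -1 < k := by exact_mod_cast hk2
        omega
      simpa [this] using hk
  have h2 : ∀ᵐ θ : ℝ ∂(MeasureTheory.volume.restrict (Set.Ico 0 (2 * Real.pi))), False := by
    rw [PosDefAEOnCircle, MeasureTheory.ae_restrict_iff' measurableSet_Ico] at h
    rw [MeasureTheory.ae_restrict_iff' measurableSet_Ico]
    have h3 : ∀ᵐ θ : ℝ, θ ∉ ({θ : ℝ | (S.map (evalCircle (Circle.exp θ))).PosDef} ∩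
      Set.Ico 0 (2 * Real.pi)) := MeasureTheory.measure_eq_zero_iff_ae_notMem.1 (h1.measure_zero _)
    filter_upwards [h, h3] with θ ha hb hmem
    exact hb ⟨ha hmem, hmem⟩
  rw [Filter.eventually_false_iff_eq_bot, MeasureTheory.ae_eq_bot,
    MeasureTheory.Measure.restrict_eq_zero, Real.volume_Ico] at h2
  simp at h2
  exact absurd h2 (not_le.2 Real.pi_pos)

theorem conjTranspose_eq_of_infinite_posDef {S : Matrix (Fin m) (Fin m) ℂ[T;T⁻¹]}
    (h : {z : Circle | (S.map (evalCircle z)).PosDef}.Infinite) : Sᴴ = S := by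
  ext1 i j
  rw [← sub_eq_zero]
  refine eq_zero_of_evalAt_circle h fun z hz => ?_
  have h1 := congrFun (congrFun hz.isHermitian i) j
  rw [← conjTranspose_map_evalCircle] at h1
  rw [map_sub, sub_eq_zero]
  exact h1

/-! ### Degree bound, uniqueness and normalisation of the determinant -/

theorem det_map_toLaurent (P : Matrix (Fin m) (Fin m) ℂ[X]) :
    (P.map Polynomial.toLaurent).det = Polynomial.toLaurent P.det :=
  (RingHom.map_det _ _).symm

theorem adjugate_map_toLaurent (P : Matrix (Fin m) (Fin m) ℂ[X]) :
    (P.map Polynomial.toLaurent).adjugate = P.adjugate.map Polynomial.toLaurent :=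
  (RingHom.map_adjugate _ _).symm

/-- Multiplying `P P̃ = S` by `adj(P)̃` gives `p̃ P = S · adj(P)̃` with `p = det P`, whose exponents
are at most `N`. As `p̃` has nonzero constant term and no positive exponents, cancelling it keeps
the bound. -/
theorem natDegree_le_of_mul_conjTranspose {P : Matrix (Fin m) (Fin m) ℂ[X]}
    {S : Matrix (Fin m) (Fin m) ℂ[T;T⁻¹]} {N : ℕ} (hS : ∀ i j, ∀ n > (N : ℤ), (S i j).coeff n = 0)
    (hdet : P.det.coeff 0 ≠ 0)
    (hP : P.map Polynomial.toLaurent * (P.map Polynomial.toLaurent)ᴴ = S) (i j : Fin m) :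
    (P i j).natDegree ≤ N := by
  set PL := P.map Polynomial.toLaurent with hPL
  have hPdet : PL.det = Polynomial.toLaurent P.det := det_map_toLaurent P
  have hadj : PL.adjugate = P.adjugate.map Polynomial.toLaurent :=
    adjugate_map_toLaurent P
  have h1 : S * (PL.adjugate)ᴴ = star (Polynomial.toLaurent P.det) • PL := by
    rw [← hP, mul_assoc, ← conjTranspose_mul, adjugate_mul, conjTranspose_smul, conjTranspose_one,
      mul_smul_comm, mul_one, hPdet]
  have h2 : ∀ n > (N : ℤ), (star (Polynomial.toLaurent P.det) * PL i j).coeff n = 0 := by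
    intro n hn
    have h3 : star (Polynomial.toLaurent P.det) * PL i j = (S * (PL.adjugate)ᴴ) i j := by
      rw [h1, Matrix.smul_apply, smul_eq_mul]
    rw [h3, Matrix.mul_apply, AddMonoidAlgebra.coeff_sum, Finsupp.finsetSum_apply]
    refine Finset.sum_eq_zero fun k _ => ?_
    rw [hadj]
    exact mul_star_toLaurent_coeff_eq_zero (hS i k) _ n hn
  rw [← exists_toLaurent_T_mul_star_iff, star_mul, star_star] at h2
  obtain ⟨s, hs⟩ := h2
  have h4 := (exists_toLaurent_T_mul_star_iff _ _).1
    (exists_toLaurent_of_mul hdet (h := T N * star (PL i j)) ⟨s, by rw [hs]; ring⟩)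
  rw [Polynomial.natDegree_le_iff_coeff_eq_zero]
  intro n hn
  rw [← toLaurent_coeff_natCast]
  exact h4 n (by omega)

theorem mul_left_cancel_of_det_ne_zero {R : Type*} [CommRing R] [IsDomain R]
    {A X Y : Matrix (Fin m) (Fin m) R} (hA : A.det ≠ 0) (h : A * X = A * Y) : X = Y := by
  have h1 := congrArg (fun M => A.adjugate * M) h
  simp only [← mul_assoc, adjugate_mul, smul_mul_assoc, one_mul] at h1
  exact smul_right_injective _ hA h1

theorem exists_unitary_of_mul_conjTranspose_eq {P Q : Matrix (Fin m) (Fin m) ℂ[X]}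
    (hdet : Q.det = P.det) (h0 : P.det.coeff 0 ≠ 0)
    (hcop : IsCoprime (Polynomial.toLaurent P.det) (star (Polynomial.toLaurent P.det)))
    (h : P.map Polynomial.toLaurent * (P.map Polynomial.toLaurent)ᴴ =
      Q.map Polynomial.toLaurent * (Q.map Polynomial.toLaurent)ᴴ) :
    ∃ U ∈ unitaryGroup (Fin m) ℂ, Q = P * U.map Polynomial.C := by
  set PL := P.map Polynomial.toLaurent with hPL
  set QL := Q.map Polynomial.toLaurent with hQL
  set p := Polynomial.toLaurent P.det with hp
  have hPdet : PL.det = p := det_map_toLaurent P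
  have hQdet : QL.det = p := by rw [hp, ← hdet]; exact det_map_toLaurent Q
  have hp0 : p ≠ 0 := by
    rw [hp, Polynomial.toLaurent_ne_zero]
    rintro h
    simp [h] at h0
  have hadjP : PL.adjugate = P.adjugate.map Polynomial.toLaurent :=
    adjugate_map_toLaurent P
  have hadjQ : QL.adjugate = Q.adjugate.map Polynomial.toLaurent :=
    adjugate_map_toLaurent Q
  -- This is `P̃ Q̃⁻¹ = P⁻¹ Q` with denominators cleared; coprimality then makes `p` divide the
  -- entries of `adj(P) Q`.
  have h1 : p • (PLᴴ * QL.adjugateᴴ) = star p • (PL.adjugate * QL) := by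
    calc p • (PLᴴ * QL.adjugateᴴ) = PL.adjugate * (PL * PLᴴ) * QL.adjugateᴴ := by
          rw [← mul_assoc PL.adjugate, adjugate_mul, hPdet, smul_mul_assoc, one_mul, smul_mul_assoc]
      _ = PL.adjugate * QL * (QL.adjugate * QL)ᴴ := by
          rw [h, conjTranspose_mul]
          simp only [mul_assoc]
      _ = _ := by
          rw [adjugate_mul, hQdet, conjTranspose_smul, conjTranspose_one, mul_smul_comm, mul_one]
  have hdvd : ∀ i j, p ∣ (PL.adjugate * QL) i j := by
    intro i j
    apply hcop.dvd_of_dvd_mul_left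
    exact ⟨_, (congrFun (congrFun h1 i) j).symm⟩
  choose u hu using hdvd
  have hu2 : ∀ i j, (PLᴴ * QL.adjugateᴴ) i j = star p * u i j := by
    intro i j
    apply mul_left_cancel₀ hp0
    have := congrFun (congrFun h1 i) j
    simp only [Matrix.smul_apply, smul_eq_mul] at this
    rw [this, hu]
    ring
  -- Both `p u` and `p ũ` are polynomials, being entries of `adj(P) Q` and `adj(Q) P`; hence so are
  -- `u` and `ũ`.
  have hconst : ∀ i j, u i j = C ((u i j).coeff 0) := by
    intro i j
    obtain ⟨s, hs⟩ := exists_toLaurent_of_mul h0 (h := u i j)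
      ⟨(P.adjugate * Q) i j, by
        rw [← hp, ← hu, hadjP, hQL, ← Matrix.map_mul]
        rfl⟩
    obtain ⟨t, ht⟩ := exists_toLaurent_of_mul h0 (h := star (u i j))
      ⟨(Q.adjugate * P) j i, by
        have h2 := congrArg star (hu2 i j)
        rw [star_mul, star_star, ← conjTranspose_mul, conjTranspose_apply, star_star, hadjQ, hPL,
          ← Matrix.map_mul, mul_comm] at h2
        exact h2⟩
    rw [← hs] at ht ⊢
    have h2 := eq_C_of_star_eq_toLaurent ht.symm
    have h3 := toLaurent_coeff_natCast s 0
    rw [Nat.cast_zero] at h3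
    rw [h3]
    conv_lhs => rw [h2]
    exact Polynomial.toLaurent_C _
  let U : Matrix (Fin m) (Fin m) ℂ := Matrix.of fun i j => (u i j).coeff 0
  have hUL : U.map (C : ℂ → ℂ[T;T⁻¹]) = Matrix.of u := by
    ext1 i j
    exact (hconst i j).symm
  have hPU : PL * U.map C = QL := by
    apply mul_left_cancel_of_det_ne_zero (A := PL.adjugate)
    · rw [det_adjugate, hPdet]
      exact pow_ne_zero _ hp0
    · rw [← mul_assoc, adjugate_mul, hPdet, smul_mul_assoc, one_mul, hUL]
      ext1 i j
      rw [hu]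
      rfl
  refine ⟨U, ?_, ?_⟩
  · rw [mem_unitaryGroup_iff, star_eq_conjTranspose]
    have h2 : U.map C * (U.map C)ᴴ = (1 : Matrix (Fin m) (Fin m) ℂ[T;T⁻¹]) := by
      have h3 : PL * ((U.map C * (U.map C)ᴴ) * PLᴴ) = PL * PLᴴ := by
        rw [h, ← hPU, conjTranspose_mul]
        simp only [mul_assoc]
      have h4 := congrArg conjTranspose (mul_left_cancel_of_det_ne_zero (by rwa [hPdet]) h3)
      rw [conjTranspose_mul, conjTranspose_conjTranspose, conjTranspose_mul,
        conjTranspose_conjTranspose] at h4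
      exact mul_left_cancel_of_det_ne_zero (A := PL) (by rwa [hPdet]) (by rw [h4, mul_one])
    rw [conjTranspose_map_C, ← Matrix.map_mul] at h2
    ext i j
    have h3 := congrArg (fun f => f.coeff 0) (congrFun (congrFun h2 i) j)
    simp only [Matrix.map_apply, C_apply, if_true] at h3
    rw [h3, Matrix.one_apply, Matrix.one_apply]
    split_ifs
    · rw [← map_one C, C_apply, if_pos rfl]
    · rfl
  · apply Matrix.map_injective Polynomial.toLaurent_injective
    beta_reduce
    rw [Matrix.map_mul, map_C_map_toLaurent]
    exact hPU.symm

/-- Comparing determinants gives `|d| = 1`, so the unitary `diag(d̄, 1, …, 1)` on the right removes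
`d`. -/
theorem exists_factorization_det_eq [NeZero m] {p : ℂ[X]} (hp : p ≠ 0)
    {S : Matrix (Fin m) (Fin m) ℂ[T;T⁻¹]}
    (hdet : S.det = Polynomial.toLaurent p * star (Polynomial.toLaurent p))
    {P : Matrix (Fin m) (Fin m) ℂ[X]} {d : ℂ}
    (hP : P.map Polynomial.toLaurent * (P.map Polynomial.toLaurent)ᴴ = S)
    (hPd : P.det = Polynomial.C d * p) :
    ∃ P' : Matrix (Fin m) (Fin m) ℂ[X],
      P'.map Polynomial.toLaurent * (P'.map Polynomial.toLaurent)ᴴ = S ∧ P'.det = p := by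
  have hd : d * star d = 1 := by
    have h1 : (P.map Polynomial.toLaurent).det = C d * Polynomial.toLaurent p := by
      rw [← Polynomial.toLaurent_C, ← map_mul, ← hPd]
      exact det_map_toLaurent P
    have h2 := hdet
    rw [← hP, det_mul, det_conjTranspose, h1, star_mul, star_C] at h2
    have hpL : Polynomial.toLaurent p ≠ 0 := Polynomial.toLaurent_ne_zero.2 hp
    have h3 : (C (d * star d) : ℂ[T;T⁻¹]) = C 1 := by
      apply mul_right_cancel₀ (mul_ne_zero hpL (star_ne_zero.2 hpL))
      rw [map_one, one_mul, map_mul]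
      linear_combination h2
    have h4 := congrArg (fun f : ℂ[T;T⁻¹] => f.coeff 0) h3
    simpa only [C_apply, if_true] using h4
  let U : Matrix (Fin m) (Fin m) ℂ := diagonal (Function.update 1 0 (star d))
  have hU : U * Uᴴ = 1 := by
    rw [diagonal_conjTranspose, diagonal_mul_diagonal, ← diagonal_one]
    congr 1
    ext1 i
    by_cases hi : i = 0
    · subst hi
      simp only [Pi.star_apply, Function.update_self, star_star]
      rw [mul_comm, hd]
    · simp [Function.update_of_ne hi]
  have hUdet : U.det = star d := by
    rw [det_diagonal, Finset.prod_update_of_mem (Finset.mem_univ _)]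
    simp
  refine ⟨P * U.map Polynomial.C, ?_, ?_⟩
  · rw [Matrix.map_mul, map_C_map_toLaurent, conjTranspose_mul, conjTranspose_map_C, mul_assoc,
      ← mul_assoc (U.map C), ← Matrix.map_mul, hU, Matrix.map_one _ (map_zero _) (map_one _), one_mul, hP]
  · have h1 : (U.map Polynomial.C).det = Polynomial.C (star d) := by
      rw [← hUdet]
      exact (RingHom.map_det _ _).symm
    rw [det_mul, h1, hPd, mul_right_comm, ← map_mul, hd, map_one, one_mul]

end SpectralFactorization

theorem theorem3 (m N : ℕ) (S : Matrix (Fin m) (Fin m) ℂ[T;T⁻¹]) (p : ℂ[X])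
    (hdeg : SpectralFactorization.HasLaurentDegree S N)
    (hpos : SpectralFactorization.PosDefAEOnCircle S)
    (hp : SpectralFactorization.IsScalarSpectralFactor p S.det)
    (hsimple : SpectralFactorization.OnlySimpleRoots S.det) :
    ∃ P : Matrix (Fin m) (Fin m) ℂ[X],
      (SpectralFactorization.IsSpectralFactor P N S ∧ P.det = p) ∧
      ∀ Q : Matrix (Fin m) (Fin m) ℂ[X],
        SpectralFactorization.IsSpectralFactor Q N S ∧ Q.det = p →
          ∃ U ∈ Matrix.unitaryGroup (Fin m) ℂ, Q = P * U.map Polynomial.C := by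
  open SpectralFactorization in
  -- For `m = 0` every coefficient matrix is zero, which `C_N ≠ 0` excludes.
  have hm : NeZero m := by
    refine ⟨?_⟩
    rintro rfl
    exact hdeg.2 (Subsingleton.elim _ _)
  have hE := infinite_posDef_of_posDefAEOnCircle hpos
  have hS := conjTranspose_eq_of_infinite_posDef hE
  have hdet0 : S.det ≠ 0 := by
    intro h
    obtain ⟨z, hz⟩ := hE.nonempty
    have h1 : IsUnit (S.map (evalCircle z)).det := (Matrix.isUnit_iff_isUnit_det _).1 hz.isUnit
    rw [← RingHom.mapMatrix_apply, ← RingHom.map_det, h, map_zero] at h1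
    exact not_isUnit_zero h1
  have hp0 : p.coeff 0 ≠ 0 := coeff_zero_ne_zero_of_isScalarSpectralFactor hdet0 hp
  have hpne : p ≠ 0 := by
    rintro rfl
    simp at hp0
  have hdet : S.det = Polynomial.toLaurent p * star (Polynomial.toLaurent p) := hp.2.symm
  have hne : ∀ z : ℂˣ, p.eval (z : ℂ) = 0 → evalAt z (star (Polynomial.toLaurent p)) ≠ 0 := by
    rw [hdet] at hsimple
    exact fun z hz => evalAt_star_ne_zero_of_onlySimpleRoots hsimple hz
  -- On the circle `p̃` is the conjugate of `p`, so a zero there would be common to both.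
  have hcircle : ∀ z : Circle, p.eval (z : ℂ) ≠ 0 := by
    intro z hz
    apply hne (Circle.toUnits z) hz
    rw [evalAt_star, evalAt_toLaurent]
    simpa using hz
  obtain ⟨P₀, d, hP₀, hP₀d⟩ := exists_factorization_up_to_const p.natDegree p S 1 _ rfl hp0 hcircle hS
    hE (fun z hz => hz) one_ne_zero (by rw [map_one, one_mul, hdet])
  obtain ⟨P, hP, hPd⟩ := exists_factorization_det_eq hpne hdet hP₀ hP₀d
  have hSN : ∀ i j, ∀ n > (N : ℤ), (S i j).coeff n = 0 := by
    intro i j n hn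
    exact congrFun (congrFun (hdeg.1 n (hn.trans_le (le_abs_self n))) i) j
  refine ⟨P, ⟨⟨natDegree_le_of_mul_conjTranspose hSN (by rwa [hPd]) hP, hP⟩, hPd⟩, ?_⟩
  rintro Q ⟨⟨-, hQ⟩, hQd⟩
  refine exists_unitary_of_mul_conjTranspose_eq (hQd.trans hPd.symm) (by rwa [hPd]) ?_
    (hP.trans hQ.symm)
  rw [hPd]
  exact isCoprime_toLaurent hp0 hne
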